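/- Let $k \ge 2$ be an integer and let $\mathbf{x} = (a(n))_{n\ge 0}$ be a $k$-automatic sequence over a finite alphabet $\Delta$; that is, there is a deterministic finite automaton with output which, on reading the canonical base-$k$ expansion of $n$ (most significant digit first, without leading zeros, the expansion of $0$ being the empty word), outputs $a(n)$, for every $n \ge 0$. For $n \ge 0$ let $p(n)$ be the number of distinct words $w$ of length $n$ that are palindromes ($w$ equals its reversal) and that occur in $\mathbf{x}$, i.e. $w = a(i)a(i+1)\cdots a(i+n-1)$ for some $i \ge 0$. Then the sequence $(p(n))_{n\ge 0}$ is $(\mathbb{N},k)$-regular: there exist finitely many sequences $f_1,\dots,f_r : \mathbb{N}\to\mathbb{N}$ such that $p$ is an $\mathbb{N}$-linear combination of $f_1,\dots,f_r$ and, for all $1\le i\le r$ and $0 \le c < k$, the sequence $(f_i(kn+c))_{n\ge 0}$ is an $\mathbb{N}$-linear combination of $f_1,\dots,f_r$. Moreover, $(p(n))_{n\ge 0}$ is $k$-automatic if and only if it is bounded. -/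

import Mathlib

namespace AutSeq

/-- The integer `[w]_k` represented in base `k` by the word `w = a₁ ⋯ aₘ` over the alphabet
`{0, …, k - 1}`, most significant digit first. -/
def wordVal {k : ℕ} (w : List (Fin k)) : ℕ :=
  Nat.ofDigits k (w.reverse.map (fun a : Fin k => (a : ℕ)))

/-- `w` is the canonical base-`k` expansion of an integer: it does not begin with the digit `0`.
The empty word is the canonical expansion of `0`. -/
def IsCanonical {k : ℕ} (w : List (Fin k)) : Prop :=
  ∀ a : Fin k, a ∈ w.head? → (a : ℕ) ≠ 0

/-- A deterministic automaton with output, with input alphabet `A`, states `Q` and output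
alphabet `D`. -/
structure DFAO (A Q D : Type*) where
  start : Q
  step : Q → A → Q
  out : Q → D

/-- The output associated with the last state reached on reading the word `w`. -/
def DFAO.run {A Q D : Type*} (M : DFAO A Q D) (w : List A) : D :=
  M.out (w.foldl M.step M.start)

/-- A sequence is `k`-automatic if some automaton with finitely many states, on reading the
canonical base-`k` expansion of `n`, outputs the `n`-th term. -/
def IsAutomatic {D : Type*} (k : ℕ) (x : ℕ → D) : Prop :=
  ∃ (Q : Type) (_ : Finite Q) (M : DFAO (Fin k) Q D),
    ∀ w : List (Fin k), IsCanonical w → M.run w = x (wordVal w)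

/-- A sequence `f` over a semiring `R` is `(R, k)`-regular if there are finitely many sequences
`g 0, …, g (r - 1)` such that `f` is an `R`-linear combination of them and, for all `i` and all
`0 ≤ a < k`, so is the subsequence `n ↦ g i (k n + a)`. -/
def IsRegular (R : Type*) [Semiring R] (k : ℕ) (f : ℕ → R) : Prop :=
  ∃ (r : ℕ) (g : Fin r → ℕ → R),
    f ∈ Submodule.span R (Set.range g) ∧
    ∀ (i : Fin r) (a : ℕ), a < k →
      (fun n => g i (k * n + a)) ∈ Submodule.span R (Set.range g)

/-- The factor `x(i) x(i+1) ⋯ x(i+n-1)` of length `n` of `x` beginning at position `i`. -/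
def factor {D : Type*} (x : ℕ → D) (i n : ℕ) : List D :=
  List.ofFn (fun t : Fin n => x (i + t))

/-- The set of palindromic factors of length `n` of `x`. -/
def palFactors {D : Type*} (x : ℕ → D) (n : ℕ) : Set (List D) :=
  {w | (∃ i, w = factor x i n) ∧ w.reverse = w}

theorem palFactors_finite {D : Type*} [Finite D] (x : ℕ → D) (n : ℕ) :
    (palFactors x n).Finite := by
  refine (List.finite_length_eq D n).subset ?_
  rintro w ⟨⟨i, rfl⟩, -⟩
  simp [factor]

/-- The number of distinct palindromic factors of length `n` of `x`. -/
noncomputable def palComplexity {D : Type*} (x : ℕ → D) (n : ℕ) : ℕ :=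
  (palFactors x n).ncard

end AutSeq

namespace AutSeq

/-! Each palindromic factor is represented by its first occurrence, so `p(n)` counts the `i`
satisfying a relation in `(i, n)` built from addition, equality of terms of `x`, negation,
conjunction and `∃`. Automata are closed under these, and counting `i` digit by digit gives an
`ℕ`-linear recursion, hence regularity. If a regular sequence is bounded, nonnegativity leaves only
finitely many relevant combinations, whose values serve as states. Conversely, an automatic sequence
takes finitely many values. -/

/-! ### Base-`k` expansions and automata -/

theorem wordVal_append_singleton {k : ℕ} (w : List (Fin k)) (a : Fin k) :
    wordVal (w ++ [a]) = k * wordVal w + a := by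
  simp [wordVal, Nat.ofDigits_cons, add_comm]

/-- The canonical base-`k` expansion of `n`. -/
def expansion (k : ℕ) [NeZero k] (n : ℕ) : List (Fin k) :=
  ((Nat.digits k n).map (Fin.ofNat k)).reverse

theorem expansion_mul_add {k : ℕ} [NeZero k] (hk : 2 ≤ k) (n : ℕ) (a : Fin k)
    (h : (a : ℕ) ≠ 0 ∨ n ≠ 0) : expansion k (k * n + a) = expansion k n ++ [a] := by
  rw [expansion, add_comm, Nat.digits_add k hk a n a.isLt h]
  simp [expansion]

theorem wordVal_expansion {k : ℕ} [NeZero k] (hk : 2 ≤ k) (n : ℕ) :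
    wordVal (expansion k n) = n := by
  have h : (Nat.digits k n).map (fun d => d % k) = Nat.digits k n := by
    conv_rhs => rw [← List.map_id (Nat.digits k n)]
    exact List.map_congr_left fun d hd => Nat.mod_eq_of_lt (Nat.digits_lt_base hk hd)
  simp only [wordVal, expansion, List.reverse_reverse, List.map_map]
  calc _ = Nat.ofDigits k ((Nat.digits k n).map (fun d => d % k)) := rfl
    _ = n := by rw [h, Nat.ofDigits_digits]

theorem isCanonical_expansion {k : ℕ} [NeZero k] (hk : 2 ≤ k) (n : ℕ) :
    IsCanonical (expansion k n) := by
  intro a ha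
  rw [expansion, List.head?_reverse, List.getLast?_map, Option.mem_def,
    Option.map_eq_some_iff] at ha
  obtain ⟨d, hd, rfl⟩ := ha
  have hne : Nat.digits k n ≠ [] := by
    intro h
    simp [h] at hd
  have hn : n ≠ 0 := Nat.digits_ne_nil_iff_ne_zero.mp hne
  rw [List.getLast?_eq_getLast_of_ne_nil hne, Option.some_inj] at hd
  have h0 := Nat.getLast_digit_ne_zero k hn
  have hlt : d < k := Nat.digits_lt_base hk (hd ▸ List.getLast_mem hne)
  rw [hd] at h0
  simpa [Fin.ofNat, Nat.mod_eq_of_lt hlt] using h0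

/-- An automatic sequence factors through a map `σ` to a finite set such that `σ (k n + a)`
depends only on `σ n` and the digit `a`. -/
theorem IsAutomatic.exists_state_map {D : Type*} {k : ℕ} (hk : 2 ≤ k) {x : ℕ → D}
    (hx : IsAutomatic k x) :
    ∃ (Q : Type) (_ : Finite Q) (σ : ℕ → Q) (δ : Q → Fin k → Q) (out : Q → D),
      (∀ (n : ℕ) (a : Fin k), σ (k * n + a) = δ (σ n) a) ∧ ∀ n, x n = out (σ n) := by
  classical
  obtain ⟨Q, hQ, M, hM⟩ := hx
  have : NeZero k := ⟨by omega⟩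
  -- The flag `n = 0` makes leading zeros be skipped: `M` is specified on canonical words only.
  refine ⟨Q × Prop, inferInstance,
    fun n => ((expansion k n).foldl M.step M.start, n = 0),
    fun q a => if q.2 ∧ (a : ℕ) = 0 then q else (M.step q.1 a, False), fun q => M.out q.1,
    fun n a => ?_, fun n => ?_⟩
  · by_cases h : n = 0 ∧ (a : ℕ) = 0
    · simp [h.1, h.2]
    · have h' : (a : ℕ) ≠ 0 ∨ n ≠ 0 := by tauto
      have h0 : ¬ (k * n + a = 0) := by
        have : k ≠ 0 := by omega
        simp only [Nat.add_eq_zero_iff, mul_eq_zero]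
        tauto
      simp only [h, if_false, expansion_mul_add hk n a h', h0, List.foldl_append,
        List.foldl_cons, List.foldl_nil]
  · have := hM _ (isCanonical_expansion hk n)
    rw [wordVal_expansion hk] at this
    exact this.symm

theorem IsAutomatic.finite_range {D : Type*} {k : ℕ} (hk : 2 ≤ k) {x : ℕ → D}
    (hx : IsAutomatic k x) : (Set.range x).Finite := by
  obtain ⟨Q, _, σ, δ, out, -, h⟩ := hx.exists_state_map hk
  refine (Set.finite_range out).subset ?_
  rintro _ ⟨n, rfl⟩
  exact ⟨σ n, (h n).symm⟩

/-! ### Recognizable relations -/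

/-- A relation between the natural numbers `e i`, `i : ι`, is recognizable in base `k` if it
factors through a map to a finite set whose value at `k e + a` depends only on its value at `e`
and on the vector of digits `a`. -/
def Recognizable (k : ℕ) {ι : Type*} (R : (ι → ℕ) → Prop) : Prop :=
  ∃ (Q : Type) (_ : Finite Q) (σ : (ι → ℕ) → Q) (δ : Q → (ι → Fin k) → Q) (S : Set Q),
    (∀ (e : ι → ℕ) (a : ι → Fin k), σ (fun i => k * e i + a i) = δ (σ e) a) ∧
      ∀ e, R e ↔ σ e ∈ S

namespace Recognizable

variable {k : ℕ} {ι : Type*} {R T : (ι → ℕ) → Prop}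

theorem congr (hR : Recognizable k R) (h : ∀ e, T e ↔ R e) : Recognizable k T := by
  rwa [show T = R from funext fun e => propext (h e)]

theorem not (hR : Recognizable k R) : Recognizable k (fun e => ¬ R e) := by
  obtain ⟨Q, hQ, σ, δ, S, hσ, hS⟩ := hR
  exact ⟨Q, hQ, σ, δ, Sᶜ, hσ, fun e => not_congr (hS e)⟩

theorem and (hR : Recognizable k R) (hT : Recognizable k T) :
    Recognizable k (fun e => R e ∧ T e) := by
  obtain ⟨Q, hQ, σ, δ, S, hσ, hS⟩ := hR
  obtain ⟨Q', hQ', σ', δ', S', hσ', hS'⟩ := hT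
  exact ⟨Q × Q', inferInstance, fun e => (σ e, σ' e), fun q a => (δ q.1 a, δ' q.2 a), S ×ˢ S',
    fun e a => Prod.ext (hσ e a) (hσ' e a), fun e => and_congr (hS e) (hS' e)⟩

/-- Subset construction, guessing the digits of `y`. Since the initial state set already ranges over
all `y`, witnesses longer than the input cause no trouble. -/
theorem exists_update [DecidableEq ι] (hk : 0 < k) (hR : Recognizable k R) (i : ι) :
    Recognizable k (fun e => ∃ y, R (Function.update e i y)) := by
  obtain ⟨Q, hQ, σ, δ, S, hσ, hS⟩ := hR
  have key (e : ι → ℕ) (a : ι → Fin k) (y : ℕ) (b : Fin k) :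
      σ (Function.update (fun j => k * e j + a j) i (k * y + b)) =
        δ (σ (Function.update e i y)) (Function.update a i b) := by
    rw [← hσ]
    congr 1
    ext j
    by_cases h : j = i
    · subst h
      simp
    · simp [h]
  refine ⟨Set Q, inferInstance, fun e => Set.range fun y => σ (Function.update e i y),
    fun A a => {q | ∃ p ∈ A, ∃ b : Fin k, q = δ p (Function.update a i b)},
    {A | (A ∩ S).Nonempty}, fun e a => ?_, fun e => ?_⟩
  · ext q
    constructor
    · rintro ⟨y, rfl⟩
      refine ⟨_, ⟨y / k, rfl⟩, ⟨y % k, Nat.mod_lt _ hk⟩, ?_⟩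
      rw [← key]
      simp only [Nat.div_add_mod]
    · rintro ⟨_, ⟨y, rfl⟩, b, rfl⟩
      exact ⟨k * y + b, key e a y b⟩
  · simp only [hS]
    constructor
    · rintro ⟨y, hy⟩
      exact ⟨_, ⟨y, rfl⟩, hy⟩
    · rintro ⟨_, ⟨y, rfl⟩, hy⟩
      exact ⟨y, hy⟩

/-- The state is `d = e r - e p - e q` clamped to `[-2, 2]`. A step sends `d` to `k * d + s` with
`-2(k-1) ≤ s ≤ k-1`, so `d ≥ 2` and `d ≤ -2` persist; as `c ≤ 1`, clamping never hides `d = c`. -/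
theorem add_eq (hk : 0 < k) (p q r : ι) {c : ℕ} (hc : c ≤ 1) :
    Recognizable k (fun e => e p + e q + c = e r) := by
  have h2 : (-2 : ℤ) ≤ 2 := by norm_num
  refine ⟨Set.Icc (-2 : ℤ) 2, inferInstance,
    fun e => Set.projIcc (-2) 2 h2 ((e r : ℤ) - e p - e q),
    fun s a => Set.projIcc (-2) 2 h2 (k * (s : ℤ) + ((a r : ℕ) - (a p : ℕ) - (a q : ℕ) : ℤ)),
    {s | (s : ℤ) = c}, fun e a => ?_, fun e => ?_⟩
  · change Set.projIcc (-2) 2 h2 (((k * e r + a r : ℕ) : ℤ) - (k * e p + a p : ℕ) -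
      (k * e q + a q : ℕ)) = Set.projIcc (-2) 2 h2 (k * (Set.projIcc (-2) 2 h2
        ((e r : ℤ) - e p - e q) : ℤ) + ((a r : ℕ) - (a p : ℕ) - (a q : ℕ) : ℤ))
    have hp := (a p).isLt
    have hq := (a q).isLt
    have hr := (a r).isLt
    apply Subtype.ext
    push_cast
    have hrw : ((k : ℤ) * e r + (a r : ℕ) - (k * e p + (a p : ℕ)) - (k * e q + (a q : ℕ))) =
        k * ((e r : ℤ) - e p - e q) + ((a r : ℕ) - (a p : ℕ) - (a q : ℕ)) := by ring
    rw [hrw]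
    generalize (e r : ℤ) - e p - e q = d
    change max (-2) (min 2 _) = max (-2) (min 2 (k * max (-2) (min 2 d) + _))
    rcases le_total 2 d with h | h
    · have h' : (k : ℤ) * 2 ≤ k * d := by gcongr
      rw [min_eq_left h, max_eq_right h2]
      omega
    rcases le_total d (-2) with h1 | h1
    · have h' : (k : ℤ) * d ≤ k * (-2) := by gcongr
      rw [min_eq_right h, max_eq_left h1]
      omega
    · rw [min_eq_right h, max_eq_right h1]
  · simp only [Set.mem_ofPred_eq, Set.coe_projIcc]
    omega

theorem _root_.AutSeq.IsAutomatic.recognizable_eq {D : Type*} (hk : 2 ≤ k) {x : ℕ → D}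
    (hx : IsAutomatic k x) (p q : ι) : Recognizable k (fun e => x (e p) = x (e q)) := by
  obtain ⟨Q, hQ, σ, δ, out, hσ, hout⟩ := hx.exists_state_map hk
  exact ⟨Q × Q, inferInstance, fun e => (σ (e p), σ (e q)),
    fun s a => (δ s.1 (a p), δ s.2 (a q)), {s | out s.1 = out s.2},
    fun e a => by simp only [hσ], fun e => by simp only [hout, Set.mem_ofPred_eq]⟩

end Recognizable

/-! ### Counting solutions and regularity -/

theorem isRegular_of_finite {R : Type*} [Semiring R] {k : ℕ} {J : Type*} [Finite J]
    (g : J → ℕ → R) {f : ℕ → R} (hf : f ∈ Submodule.span R (Set.range g))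
    (hg : ∀ (i : J) (a : ℕ), a < k →
      (fun n => g i (k * n + a)) ∈ Submodule.span R (Set.range g)) : IsRegular R k f := by
  obtain ⟨r, ⟨φ⟩⟩ := Finite.exists_equiv_fin J
  have hrange : Set.range (g ∘ φ.symm) = Set.range g := φ.symm.surjective.range_comp g
  exact ⟨r, g ∘ φ.symm, by rwa [hrange], fun i a ha => by rw [hrange]; exact hg _ a ha⟩

/-- Splitting a finite set of integers into residue classes modulo `k`. -/
theorem ncard_eq_sum_residues {k : ℕ} (hk : 0 < k) {A : Set ℕ} (hA : A.Finite) :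
    A.ncard = ∑ a : Fin k, {i | k * i + (a : ℕ) ∈ A}.ncard := by
  classical
  have : NeZero k := ⟨hk.ne'⟩
  have hfib (a : Fin k) : {i | k * i + (a : ℕ) ∈ A}.ncard =
      (hA.toFinset.filter fun j => Fin.ofNat k j = a).card := by
    rw [← Set.ncard_coe_finset]
    have hinj : Function.Injective (fun i => k * i + (a : ℕ)) := fun i j h => by
      have : k * i = k * j := Nat.add_right_cancel h
      exact Nat.eq_of_mul_eq_mul_left hk this
    rw [← Set.ncard_image_of_injective _ hinj]
    congr 1
    ext j
    simp only [Set.mem_image, Set.mem_ofPred_eq, Finset.coe_filter, Set.Finite.mem_toFinset]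
    constructor
    · rintro ⟨i, hi, rfl⟩
      refine ⟨hi, Fin.ext ?_⟩
      simp [Fin.ofNat, Nat.mod_eq_of_lt a.isLt]
    · rintro ⟨hj, rfl⟩
      refine ⟨j / k, ?_, Nat.div_add_mod j k⟩
      rw [show k * (j / k) + ((Fin.ofNat k j : Fin k) : ℕ) = j from Nat.div_add_mod j k]
      exact hj
  rw [Set.ncard_eq_toFinset_card A hA, Finset.sum_congr rfl fun a _ => hfib a]
  exact Finset.card_eq_sum_card_fiberwise fun j _ => Finset.mem_coe.mpr (Finset.mem_univ _)

/-- If `R i n` is recognizable and holds for only finitely many `i` for each `n`, then the number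
of these `i` is a regular sequence. -/
theorem Recognizable.isRegular_ncard {k : ℕ} (hk : 0 < k) {R : ℕ → ℕ → Prop}
    (hR : Recognizable k (fun e : ℕ → ℕ => R (e 0) (e 1))) (hfin : ∀ n, {i | R i n}.Finite) :
    IsRegular ℕ k (fun n => {i | R i n}.ncard) := by
  obtain ⟨Q, hQ, σ, δ, S, hσ, hS⟩ := hR
  let env : ∀ {α : Type}, α → α → ℕ → α := fun i n t => if t = 0 then i else n
  have hstep (i n : ℕ) (a b : Fin k) :
      σ (env (k * i + a) (k * n + b)) = δ (σ (env i n)) (env a b) := by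
    rw [← hσ]
    congr 1
    ext t
    by_cases h : t = 0 <;> simp [env, h]
  have hRS (i n : ℕ) : R i n ↔ σ (env i n) ∈ S := hS (env i n)
  -- Finiteness is required because `ncard` of an infinite set is `0`, which would break additivity
  -- over residue classes.
  let J := {T : Set Q // ∀ n, {i | σ (env i n) ∈ T}.Finite}
  let g : J → ℕ → ℕ := fun T n => {i | σ (env i n) ∈ T.1}.ncard
  refine isRegular_of_finite g (Submodule.subset_span
    ⟨⟨S, fun n => by simpa only [hRS] using hfin n⟩, ?_⟩) fun T b hb => ?_
  · ext n
    simp only [g, hRS]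
  · let T' (a : Fin k) : J := ⟨{q | δ q (env a ⟨b, hb⟩) ∈ T.1}, fun n => by
      have hinj : Function.Injective (fun i => k * i + (a : ℕ)) := fun i j h => by
        have : k * i = k * j := Nat.add_right_cancel h
        exact Nat.eq_of_mul_eq_mul_left hk this
      refine ((T.2 (k * n + b)).preimage hinj.injOn).subset fun i hi => ?_
      have := hstep i n a ⟨b, hb⟩
      simp only [Set.mem_preimage, Set.mem_ofPred_eq] at hi ⊢
      exact this ▸ hi⟩
    have heq : (fun n => g T (k * n + b)) = ∑ a : Fin k, g (T' a) := by
      ext n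
      rw [Finset.sum_apply]
      simp only [g]
      rw [ncard_eq_sum_residues hk (T.2 (k * n + b))]
      refine Finset.sum_congr rfl fun a _ => ?_
      congr 1
      ext i
      have := hstep i n a ⟨b, hb⟩
      simp only [Set.mem_ofPred_eq, T']
      rw [← this]
    rw [heq]
    exact Submodule.sum_mem _ fun a _ => Submodule.subset_span ⟨T' a, rfl⟩

/-! ### Bounded regular sequences -/

/-- A bounded `(ℕ, k)`-regular sequence is `k`-automatic. -/
theorem IsRegular.isAutomatic_of_bddAbove {k : ℕ} {f : ℕ → ℕ} (hf : IsRegular ℕ k f)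
    (hb : BddAbove (Set.range f)) : IsAutomatic k f := by
  obtain ⟨r, g, hfg, hg⟩ := hf
  obtain ⟨B, hB⟩ := hb
  let K : Set (ℕ → ℕ) := {h | h ∈ Submodule.span ℕ (Set.range g) ∧ ∀ n, h n ≤ B}
  have hfK : f ∈ K := ⟨hfg, fun n => hB ⟨n, rfl⟩⟩
  have hK (a : Fin k) (h : ℕ → ℕ) (hh : h ∈ K) : (fun n => h (k * n + a)) ∈ K := by
    refine ⟨?_, fun n => hh.2 _⟩
    have hle : Submodule.span ℕ (Set.range g) ≤ (Submodule.span ℕ (Set.range g)).comap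
        (LinearMap.funLeft ℕ ℕ fun n => k * n + (a : ℕ)) := by
      rw [Submodule.span_le]
      rintro _ ⟨i, rfl⟩
      exact hg i a a.isLt
    exact hle hh.1
  have hfinite : K.Finite := by
    refine (Set.finite_range fun c : Fin r → Fin (B + 1) => ∑ i, (c i : ℕ) • g i).subset ?_
    rintro h ⟨hspan, hle⟩
    obtain ⟨c, rfl⟩ := (Submodule.mem_span_range_iff_exists_fun ℕ).mp hspan
    -- Truncation is harmless: wherever `g i n ≠ 0`, `c i ≤ c i * g i n ≤ h n ≤ B`.
    refine ⟨fun i => ⟨min (c i) B, by omega⟩, Finset.sum_congr rfl fun i _ => ?_⟩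
    ext n
    simp only [Pi.smul_apply, smul_eq_mul]
    rcases Nat.eq_zero_or_pos (g i n) with h0 | h0
    · simp [h0]
    · have h1 := hle n
      simp only [Finset.sum_apply, Pi.smul_apply, smul_eq_mul] at h1
      have h2 : c i * g i n ≤ ∑ j, c j * g j n :=
        Finset.single_le_sum (f := fun j => c j * g j n) (fun j _ => Nat.zero_le _)
          (Finset.mem_univ i)
      have h3 : c i ≤ c i * g i n := Nat.le_mul_of_pos_right _ h0
      rw [min_eq_left (by omega)]
  have : Finite K := hfinite
  -- After reading `w` the state is evaluation `h ↦ h (wordVal w)` on `K`.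
  let M : DFAO (Fin k) (K → Fin (B + 1)) ℕ :=
    { start := fun h => ⟨h.1 0, Nat.lt_succ_of_le (h.2.2 0)⟩
      step := fun φ a h => φ ⟨_, hK a h.1 h.2⟩
      out := fun φ => φ ⟨f, hfK⟩ }
  have hrun (w : List (Fin k)) (h : K) : (w.foldl M.step M.start h : ℕ) = h.1 (wordVal w) := by
    induction w using List.reverseRecOn generalizing h with
    | nil => simp [M, wordVal]
    | append_singleton w a ih =>
      rw [List.foldl_append, wordVal_append_singleton]
      exact ih ⟨_, hK a h.1 h.2⟩
  exact ⟨K → Fin (B + 1), inferInstance, M, fun w _ => hrun w ⟨f, hfK⟩⟩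

/-! ### Palindromes and first occurrences -/

/-- `x(i) ⋯ x(i+n-1)` is a palindrome. -/
def PalAt {D : Type*} (x : ℕ → D) (i n : ℕ) : Prop :=
  ∀ s t, s + t + 1 = n → x (i + s) = x (i + t)

/-- `x(i) ⋯ x(i+n-1)` does not occur in `x` at any position before `i`. -/
def FirstAt {D : Type*} (x : ℕ → D) (i n : ℕ) : Prop :=
  ∀ j < i, ∃ t < n, x (i + t) ≠ x (j + t)

theorem factor_eq_factor_iff {D : Type*} (x : ℕ → D) (i j n : ℕ) :
    factor x i n = factor x j n ↔ ∀ t < n, x (i + t) = x (j + t) := by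
  rw [factor, factor, List.ofFn_inj, funext_iff]
  exact ⟨fun h t ht => h ⟨t, ht⟩, fun h t => h t t.2⟩

theorem reverse_factor_eq_iff {D : Type*} (x : ℕ → D) (i n : ℕ) :
    (factor x i n).reverse = factor x i n ↔ PalAt x i n := by
  have hrev : (factor x i n).reverse = List.ofFn (fun t : Fin n => x (i + t.rev)) := by
    refine List.ext_getElem (by simp [factor]) fun t h1 h2 => ?_
    simp only [factor, List.getElem_reverse, List.getElem_ofFn, List.length_ofFn, Fin.val_rev]
    congr 2
    omega
  rw [hrev, factor, List.ofFn_inj, funext_iff]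
  constructor
  · intro h s t hst
    have := h ⟨t, by omega⟩
    simp only [Fin.val_rev] at this
    rwa [show n - (t + 1) = s by omega] at this
  · intro h t
    have ht := t.isLt
    exact h _ _ (by simp only [Fin.val_rev]; omega)

theorem injOn_factor {D : Type*} (x : ℕ → D) (n : ℕ) :
    Set.InjOn (fun i => factor x i n) {i | PalAt x i n ∧ FirstAt x i n} := by
  intro i hi j hj hij
  have h := (factor_eq_factor_iff x i j n).mp hij
  rcases lt_trichotomy i j with hlt | heq | hlt
  · obtain ⟨t, ht, hne⟩ := hj.2 i hlt
    exact absurd (h t ht).symm hne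
  · exact heq
  · obtain ⟨t, ht, hne⟩ := hi.2 j hlt
    exact absurd (h t ht) hne

theorem image_factor {D : Type*} (x : ℕ → D) (n : ℕ) :
    (fun i => factor x i n) '' {i | PalAt x i n ∧ FirstAt x i n} = palFactors x n := by
  classical
  ext w
  constructor
  · rintro ⟨i, hi, rfl⟩
    exact ⟨⟨i, rfl⟩, (reverse_factor_eq_iff x i n).mpr hi.1⟩
  · rintro ⟨hw, hrev⟩
    refine ⟨Nat.find hw, ⟨?_, fun j hj => ?_⟩, (Nat.find_spec hw).symm⟩
    · rw [← reverse_factor_eq_iff, ← Nat.find_spec hw, hrev]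
    · by_contra! hcon
      refine Nat.find_min hw hj ?_
      rw [← (factor_eq_factor_iff x _ j n).mpr hcon]
      exact Nat.find_spec hw

theorem recognizable_palAt_firstAt {D : Type*} {k : ℕ} (hk : 2 ≤ k) {x : ℕ → D}
    (hx : IsAutomatic k x) :
    Recognizable k (fun e : ℕ → ℕ => PalAt x (e 0) (e 1) ∧ FirstAt x (e 0) (e 1)) := by
  have hk0 : 0 < k := by omega
  have add (p q r : ℕ) {c : ℕ} (hc : c ≤ 1) :
    Recognizable k (fun e : ℕ → ℕ => e p + e q + c = e r) := Recognizable.add_eq hk0 p q r hc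
  have ne (p q : ℕ) : Recognizable k (fun e : ℕ → ℕ => ¬ x (e p) = x (e q)) :=
    (hx.recognizable_eq hk p q).not
  -- Variables 0 and 1 are `i` and `n`. In `PalAt`, 2 and 3 are `s` and `t`; in `FirstAt`, 2 is `j`
  -- and 3 is `t` (or the slack in `j < i`). The others hold slacks and positions in `x`; each `∀`
  -- is `¬∃¬`.
  refine .and (.congr ((((((add 2 3 1 le_rfl).and ((add 0 2 4 zero_le_one).and
    ((add 0 3 5 zero_le_one).and (ne 4 5)))).exists_update hk0 5).exists_update hk0
    4).exists_update hk0 3).exists_update hk0 2).not fun e => ?_)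
    (.congr (((add 3 2 0 le_rfl).exists_update hk0 3 |>.and
    (((((add 4 3 1 le_rfl).and ((add 0 3 5 zero_le_one).and
    ((add 2 3 6 zero_le_one).and (ne 5 6)))).exists_update hk0 6).exists_update hk0
    5).exists_update hk0 4 |>.exists_update hk0 3).not).exists_update hk0 2).not fun e => ?_)
  · simp [PalAt]
  · have hlt (a b : ℕ) : a < b ↔ ∃ s, s + a + 1 = b :=
      ⟨fun h => ⟨b - a - 1, by omega⟩, fun ⟨s, h⟩ => by omega⟩
    simp [FirstAt, hlt]

theorem isRegular_palComplexity {D : Type*} [Finite D] {k : ℕ} (hk : 2 ≤ k) {x : ℕ → D}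
    (hx : IsAutomatic k x) : IsRegular ℕ k (palComplexity x) := by
  have hcount : palComplexity x = fun n => {i | PalAt x i n ∧ FirstAt x i n}.ncard := by
    ext n
    rw [palComplexity, ← image_factor, (injOn_factor x n).ncard_image]
  rw [hcount]
  refine Recognizable.isRegular_ncard (R := fun i n => PalAt x i n ∧ FirstAt x i n) (by omega)
    (recognizable_palAt_firstAt hk hx) fun n => ?_
  exact Set.Finite.of_finite_image (image_factor x n ▸ palFactors_finite x n) (injOn_factor x n)

end AutSeq

theorem mainTheorem8 (k : ℕ) (hk : 2 ≤ k) {D : Type*} [Finite D] (x : ℕ → D)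
    (hx : AutSeq.IsAutomatic k x) :
    AutSeq.IsRegular ℕ k (AutSeq.palComplexity x) ∧
      (AutSeq.IsAutomatic k (AutSeq.palComplexity x) ↔
        BddAbove (Set.range (AutSeq.palComplexity x))) := by
  have hreg := AutSeq.isRegular_palComplexity hk hx
  exact ⟨hreg, fun h => (h.finite_range hk).bddAbove, hreg.isAutomatic_of_bddAbove⟩
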